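/- Let $(\mathcal M,d)$ be a complete uniquely geodesic metric space: any two points $p,q$ are joined by exactly one geodesic $\gamma_p^q:[0,d(p,q)]\to\mathcal M$, meaning a map with $\gamma_p^q(0)=p$, $\gamma_p^q(d(p,q))=q$ and $d(\gamma_p^q(s),\gamma_p^q(t))=|s-t|$. For $q,r\ne p$ let $$\bar\angle_p(q,r)=\arccos\frac{d(p,q)^2+d(p,r)^2-d(q,r)^2}{2d(p,q)d(p,r)},\qquad \angle_p(q,r)=\lim_{\rho\downarrow0}\ \sup_{0<s,t<\rho}\bar\angle_p\big(\gamma_p^q(t),\gamma_p^r(s)\big)$$ be the comparison angle and the Alexandrov angle. Suppose that, for constants $C_U>0$ and $\alpha_U\in(0,1]$, $$|d(p,q)\cos\angle_p(u,q)-d(p,r)\cos\angle_p(u,r)|\le C_U\,d(q,r)^{\alpha_U}\qquad\text{for all } p,q,r,u\in\mathcal M,\ u\ne p,$$ where a product with a factor $d(p,p)=0$ is read as $0$. Let $X$ be an $\mathcal M$-valued random element with law $P$, let $\mu^*$ be a Fréchet mean of $X$ (a minimizer of $p\mapsto\mathbb E[d^2(p,X)]$), and suppose that $0<\sigma_X^2:=\mathbb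 E[d^2(\mu^*,X)]<\infty$. For $\beta\in\mathcal M$, the binary regression model with parameter $\beta$ is the law of $(X,Y)\in\mathcal M\times\{0,1\}$ for which $X$ has law $P$ and $$\log\frac{\mathbb P(Y=1\mid X)}{1-\mathbb P(Y=1\mid X)}=d(\mu^*,X)\,d(\mu^*,\beta)\cos\angle_{\mu^*}(X,\beta)$$ (the right-hand side is $0$ if $X=\mu^*$ or $\beta=\mu^*$). Let $\mathbb E_\beta$ be the expectation when $(X_1,Y_1),\dots,(X_n,Y_n)$ are i.i.d. from this law, and let $$R_n=\inf_{\hat\beta_n}\ \sup_{\beta\in\mathcal M}\mathbb E_\beta\big[d^2(\beta,\hat\beta_n)\big],$$ the infimum being over all estimators, that is, all measurable functions of the data with values in $\mathcal M$. Let $N(\epsilon,\mathcal M,d)$ be the smallest number of closed balls of radius $\epsilon$ that cover $\mathcal M$, and let $D>0$ and $c_1,c_2>0$. (a) If $c_1(1/\epsilon)^D\le N(\epsilon,\mathcal M,d)\le c_2(1/\epsilon)^D$ for all sufficiently small $\epsilon>0$, then $$R_n\ \ge\ c\left(\frac{D}{\sigma_X^2\,n}\right)^{1/\alpha_U}\qquad\text{for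 all sufficiently large } n,$$ where $c>0$ depends only on $C_U,\alpha_U,c_1,c_2$. (b) If $c_1(1/\epsilon)^D\le \log N(\epsilon,\mathcal M,d)\le c_2(1/\epsilon)^D$ (with $N(\epsilon,\mathcal M,d)<\infty$) for all sufficiently small $\epsilon>0$, then $$R_n\ \ge\ c\left(\frac{1}{\sigma_X^2\,n}\right)^{1/(\alpha_U+D/2)}\qquad\text{for all sufficiently large } n,$$ where $c>0$ depends only on $C_U,\alpha_U,c_1,c_2,D$. -/

import Mathlib

open MeasureTheory Filter Topology
open scoped ENNReal NNReal

namespace MetricRegression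

noncomputable section

/-! ### Geodesics and Alexandrov angles -/

/-- `γ`, restricted to `[0, d(p,q)]`, is a geodesic connecting `p` to `q`. -/
def IsGeodesic {M : Type*} [MetricSpace M] (γ : ℝ → M) (p q : M) : Prop :=
  γ 0 = p ∧ γ (dist p q) = q ∧
    ∀ s ∈ Set.Icc 0 (dist p q), ∀ t ∈ Set.Icc 0 (dist p q), dist (γ s) (γ t) = |s - t|

/-- Every two points are connected by a geodesic, and this geodesic, as a map on `[0, d(p,q)]`,
is unique. -/
def UniquelyGeodesic (M : Type*) [MetricSpace M] : Prop :=
  ∀ p q : M, ∃ γ : ℝ → M, IsGeodesic γ p q ∧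
    ∀ η : ℝ → M, IsGeodesic η p q → Set.EqOn η γ (Set.Icc 0 (dist p q))

open Classical in
/-- The geodesic connecting `p` to `q`; only its values on `[0, d(p,q)]` are meaningful, and there
they are determined by `p` and `q` in a uniquely geodesic space. -/
def geod {M : Type*} [MetricSpace M] (p q : M) : ℝ → M :=
  if h : ∃ γ : ℝ → M, IsGeodesic γ p q then h.choose else fun _ => p

/-- The comparison angle between `q` and `r` at `p`. -/
def comparisonAngle {M : Type*} [MetricSpace M] (p q r : M) : ℝ :=
  Real.arccos ((dist p q ^ 2 + dist p r ^ 2 - dist q r ^ 2) / (2 * dist p q * dist p r))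

/-- The Alexandrov angle between two geodesics emanating from `p`: the limit, as `r` decreases
to `0`, of the supremum of the comparison angles at `p` of `γ t` and `η s` over `0 < t, s < r`. -/
def geodesicAngle {M : Type*} [MetricSpace M] (p : M) (γ η : ℝ → M) : ℝ :=
  limUnder (𝓝[>] (0 : ℝ)) fun r : ℝ =>
    sSup {θ : ℝ | ∃ t s : ℝ, 0 < t ∧ t < r ∧ 0 < s ∧ s < r ∧
      θ = comparisonAngle p (γ t) (η s)}

/-- The Alexandrov angle `∠_p(q, r)`, meaningful for `q ≠ p` and `r ≠ p`. -/
def angle {M : Type*} [MetricSpace M] (p q r : M) : ℝ :=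
  geodesicAngle p (geod p q) (geod p r)

/-- The projection regularity condition with constant `C` and exponent `α`:
`|d(p,q) cos ∠_p(u,q) - d(p,r) cos ∠_p(u,r)| ≤ C d(q,r)^α`. The angles have no meaning at `u = p`,
so nothing is required there; at `q = p` or `r = p` the term containing the meaningless angle
has the factor `0`. -/
def ProjectionHolder (M : Type*) [MetricSpace M] (C α : ℝ) : Prop :=
  ∀ p q r u : M, u ≠ p →
    |dist p q * Real.cos (angle p u q) - dist p r * Real.cos (angle p u r)| ≤ C * dist q r ^ α

/-! ### The binary regression model -/

/-- The log odds `h(β; x, μ) = d(μ,x) d(μ,β) cos ∠_μ(x,β)`. -/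
def logOdds {M : Type*} [MetricSpace M] (β x μ : M) : ℝ :=
  dist μ x * dist μ β * Real.cos (angle μ x β)

/-- The Fréchet functional `p ↦ E[d²(p, X)]` for `X` with law `P`. -/
def frechetFunctional {M : Type*} [MetricSpace M] [MeasurableSpace M] (P : Measure M) (p : M) :
    ℝ≥0∞ :=
  ∫⁻ x, edist p x ^ 2 ∂P

/-- `μ` is a Fréchet mean of the law `P`, that is, a minimizer of the Fréchet functional. -/
def IsFrechetMean {M : Type*} [MetricSpace M] [MeasurableSpace M] (P : Measure M) (μ : M) : Prop :=
  ∀ p : M, frechetFunctional P μ ≤ frechetFunctional P p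

/-- The law of one observation `(X, Y)`, with `Y = true` standing for `Y = 1`: `X` has law `P`, and
given `X = x` the response equals `1` with the probability `p` for which
`log (p / (1 - p)) = h(β; x, μ)`, namely `p = 1 / (1 + exp (-h(β; x, μ)))`. -/
def observationLaw {M : Type*} [MetricSpace M] [MeasurableSpace M] (P : Measure M) (μ β : M) :
    Measure (M × Bool) :=
  (P.prod Measure.count).withDensity fun z =>
    ENNReal.ofReal (if z.2 then Real.sigmoid (logOdds β z.1 μ)
      else 1 - Real.sigmoid (logOdds β z.1 μ))

/-- The law of `n` i.i.d. observations. -/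
def sampleLaw {M : Type*} [MetricSpace M] [MeasurableSpace M] (P : Measure M) (μ β : M) (n : ℕ) :
    Measure (Fin n → M × Bool) :=
  Measure.pi fun _ => observationLaw P μ β

/-- The minimax risk for `n` observations: the infimum over all estimators (measurable maps from
samples to `M`) of the largest expected squared distance to the true parameter `β ∈ M`. -/
def minimaxRisk {M : Type*} [MetricSpace M] [MeasurableSpace M] (P : Measure M) (μ : M) (n : ℕ) :
    ℝ≥0∞ :=
  ⨅ (b : (Fin n → M × Bool) → M) (_ : Measurable b),
    ⨆ β : M, ∫⁻ z, edist β (b z) ^ 2 ∂(sampleLaw P μ β n)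

/-! ### Global metric entropy -/

/-- `N(ε, M, d) ≍ (1/ε)^D` as `ε` decreases to `0`, with constants `c₁` and `c₂`. -/
def LogPolynomialEntropy (M : Type*) [MetricSpace M] (c₁ c₂ D : ℝ) : Prop :=
  ∀ᶠ ε : ℝ≥0 in 𝓝[>] 0,
    Metric.coveringNumber ε (Set.univ : Set M) ≠ ⊤ ∧
    c₁ * (1 / (ε : ℝ)) ^ D ≤ ((Metric.coveringNumber ε (Set.univ : Set M)).toNat : ℝ) ∧
    ((Metric.coveringNumber ε (Set.univ : Set M)).toNat : ℝ) ≤ c₂ * (1 / (ε : ℝ)) ^ D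

/-- `log N(ε, M, d) ≍ (1/ε)^D` as `ε` decreases to `0`, with constants `c₁` and `c₂`. -/
def PolynomialEntropy (M : Type*) [MetricSpace M] (c₁ c₂ D : ℝ) : Prop :=
  ∀ᶠ ε : ℝ≥0 in 𝓝[>] 0,
    Metric.coveringNumber ε (Set.univ : Set M) ≠ ⊤ ∧
    c₁ * (1 / (ε : ℝ)) ^ D ≤ Real.log (Metric.coveringNumber ε (Set.univ : Set M)).toNat ∧
    Real.log (Metric.coveringNumber ε (Set.univ : Set M)).toNat ≤ c₂ * (1 / (ε : ℝ)) ^ D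

end

end MetricRegression

/-!
The lower bound comes from testing among well separated parameters. If `T` is an `s`-separated set,
then an estimator with squared risk below `s² / 8` identifies each `β ∈ T` with probability at least
`1 / 2`, as it lies within `s / 2` of at most one of them. This is impossible when all `β ∈ T` have
a likelihood ratio with respect to one common law `Q` whose second moment is small compared with
`#T`: the events of identifying the different `β` are disjoint, so they are too unlikely under `Q`.

For `Q` we take the law of the sample under the center `β₀` of a ball of radius `δ` containing `T`.
By the projection condition the log odds under `β` and `β₀` at `x` differ by at most
`C δᵅ d(μ, x)`, and for log odds at distance `t ≤ 1` the likelihood ratio of a single response has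
second moment at most `1 + t² / 2`. The second moment for `n` observations is therefore at most
`exp ((C δᵅ)² σ² n / 2)`.

By pigeonhole some ball of radius `δ` contains an `ηδ`-separated set of at least `N(ηδ) / N(δ)`
points, so it remains to choose `δ` with `N(ηδ) / N(δ) ≥ 16 exp ((C δᵅ)² σ² n / 2)`. Under (a) the
left-hand side is at least `16 exp D` for a fixed small `η`, which allows `δ²ᵅ` of order
`D / (σ² n)`; here one needs `D ≥ 1`, which holds since `M` is connected and not a point. Under (b)
it is at least `16 exp (δ⁻ᴰ)`, which allows `δ²ᵅ⁺ᴰ` of order `1 / (σ² n)`.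
-/

namespace MetricRegression

open Metric Set

section ProductMeasures

theorem lintegral_pi_fin_prod {n : ℕ} {Ω : Fin n → Type*} [∀ i, MeasurableSpace (Ω i)]
    (Q : ∀ i, Measure (Ω i)) [∀ i, SigmaFinite (Q i)] {f : ∀ i, Ω i → ℝ≥0∞}
    (hf : ∀ i, Measurable (f i)) :
    ∫⁻ z, ∏ i, f i (z i) ∂Measure.pi Q = ∏ i, ∫⁻ x, f i x ∂Q i := by
  induction n with
  | zero => simp
  | succ n ih =>
    have hg : Measurable fun z : ∀ i : Fin n, Ω i.succ => ∏ i, f i.succ (z i) :=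
      Finset.measurable_fun_prod _ fun i _ => (hf i.succ).comp (measurable_pi_apply i)
    rw [← (measurePreserving_piFinSuccAbove Q 0).symm.lintegral_comp_emb
      (MeasurableEquiv.measurableEmbedding _), Fin.prod_univ_succ,
      ← ih (fun i => Q i.succ) fun i => hf i.succ,
      ← lintegral_prod_mul (hf 0).aemeasurable hg.aemeasurable]
    simp_rw [MeasurableEquiv.piFinSuccAbove_symm_apply, Fin.insertNthEquiv, Fin.prod_univ_succ,
      Fin.insertNth_zero]
    rfl

variable {ι : Type*} [Fintype ι] {Ω : ι → Type*} [∀ i, MeasurableSpace (Ω i)]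
  (Q : ∀ i, Measure (Ω i)) [∀ i, SigmaFinite (Q i)] {f : ∀ i, Ω i → ℝ≥0∞}

theorem lintegral_pi_prod (hf : ∀ i, Measurable (f i)) :
    ∫⁻ z, ∏ i, f i (z i) ∂Measure.pi Q = ∏ i, ∫⁻ x, f i x ∂Q i := by
  let e := (Fintype.equivFin ι).symm
  rw [← (measurePreserving_piCongrLeft Q e).lintegral_comp_emb
    (MeasurableEquiv.measurableEmbedding _)]
  simp_rw [← e.prod_comp, MeasurableEquiv.coe_piCongrLeft, Equiv.piCongrLeft_apply_apply]
  exact lintegral_pi_fin_prod (fun i => Q (e i)) fun i => hf (e i)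

theorem pi_withDensity (hf : ∀ i, Measurable (f i))
    [∀ i, SigmaFinite ((Q i).withDensity (f i))] :
    Measure.pi (fun i => (Q i).withDensity (f i)) =
      (Measure.pi Q).withDensity fun z => ∏ i, f i (z i) := by
  refine Measure.pi_eq fun s hs => ?_
  rw [withDensity_apply _ (MeasurableSet.univ_pi hs), Measure.restrict_pi_pi,
    lintegral_pi_prod _ hf]
  exact Finset.prod_congr rfl fun i _ => (withDensity_apply _ (hs i)).symm

end ProductMeasures

section Testing

variable {Ω ι : Type*} [MeasurableSpace Ω]

theorem le_add_sq_div {t : ℝ≥0∞} (ht : t ≠ 0) (ht' : t ≠ ⊤) (x : ℝ≥0∞) : x ≤ t + x ^ 2 / t := by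
  rcases le_total x t with h | h
  · exact h.trans le_self_add
  · calc x = x * t / t := (ENNReal.mul_div_cancel_right ht ht').symm
      _ ≤ x ^ 2 / t := by rw [sq]; gcongr
      _ ≤ t + x ^ 2 / t := le_add_self

theorem withDensity_apply_le_add_div (Q : Measure Ω) {A : Set Ω} (hA : MeasurableSet A)
    (L : Ω → ℝ≥0∞) {t : ℝ≥0∞} (ht : t ≠ 0) (ht' : t ≠ ⊤) :
    Q.withDensity L A ≤ t * Q A + (∫⁻ z, L z ^ 2 ∂Q) / t := by
  calc Q.withDensity L A = ∫⁻ z in A, L z ∂Q := withDensity_apply L hA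
    _ ≤ ∫⁻ z in A, (t + L z ^ 2 / t) ∂Q := lintegral_mono fun z => le_add_sq_div ht ht' _
    _ = t * Q A + (∫⁻ z in A, L z ^ 2 ∂Q) / t := by
      rw [lintegral_add_left measurable_const, setLIntegral_const]
      simp_rw [div_eq_mul_inv]
      rw [lintegral_mul_const' _ _ (ENNReal.inv_ne_top.2 ht)]
    _ ≤ t * Q A + (∫⁻ z, L z ^ 2 ∂Q) / t := by
      gcongr
      exact Measure.restrict_le_self

theorem sum_withDensity_apply_le_card_div_two (Q : Measure Ω) [IsProbabilityMeasure Q]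
    {T : Finset ι} {L : ι → Ω → ℝ≥0∞} {A : ι → Set Ω} {B : ℝ≥0∞}
    (hA : ∀ i ∈ T, MeasurableSet (A i)) (hdisj : (T : Set ι).PairwiseDisjoint A)
    (hB : ∀ i ∈ T, ∫⁻ z, L i z ^ 2 ∂Q ≤ B) (hcard : 16 * B ≤ T.card) :
    ∑ i ∈ T, Q.withDensity (L i) (A i) ≤ T.card / 2 := by
  rcases T.eq_empty_or_nonempty with rfl | hT
  · simp
  set m := (T.card : ℝ≥0∞)
  have hm : m / 4 ≠ 0 := by simp [m, hT.ne_empty]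
  have hm' : m / 4 ≠ ⊤ := ENNReal.div_ne_top (ENNReal.natCast_ne_top _) (by norm_num)
  have hQA : ∑ i ∈ T, Q (A i) ≤ 1 := by
    rw [← measure_biUnion_finset hdisj hA]
    exact prob_le_one
  have hBm : m * (B / (m / 4)) ≤ m / 4 := by
    have h4m : 4 * (m / 4) = m := ENNReal.mul_div_cancel (by norm_num) (by norm_num)
    calc m * (B / (m / 4)) = 4 * (m / 4 * (B / (m / 4))) := by rw [← mul_assoc, h4m]
      _ = 4 * B := by rw [ENNReal.mul_div_cancel hm hm']
      _ ≤ m / 4 := by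
        rw [ENNReal.le_div_iff_mul_le (by simp) (by simp)]
        exact (by ring : 4 * B * 4 = 16 * B).trans_le hcard
  calc ∑ i ∈ T, Q.withDensity (L i) (A i)
      ≤ ∑ i ∈ T, (m / 4 * Q (A i) + B / (m / 4)) := by
        refine Finset.sum_le_sum fun i hi =>
          (withDensity_apply_le_add_div Q (hA i hi) (L i) hm hm').trans ?_
        gcongr
        exact hB i hi
    _ = m / 4 * ∑ i ∈ T, Q (A i) + m * (B / (m / 4)) := by
        rw [Finset.sum_add_distrib, ← Finset.mul_sum, Finset.sum_const, nsmul_eq_mul]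
    _ ≤ m / 4 * 1 + m / 4 := by gcongr
    _ = m / 2 := by
        rw [mul_one, ← ENNReal.add_div, ← two_mul, show (4 : ℝ≥0∞) = 2 * 2 by norm_num,
          ENNReal.mul_div_mul_left _ _ (by norm_num) (by norm_num)]

end Testing

section Estimation

variable {M : Type*} [PseudoEMetricSpace M]

theorem pairwiseDisjoint_edist_lt_half {Ω : Type*} {s : ℝ≥0∞} {T : Set M}
    (hT : IsSeparated s T) (b : Ω → M) :
    T.PairwiseDisjoint fun β => {z | edist β (b z) < s / 2} := by
  intro β hβ β' hβ' hne
  refine Set.disjoint_left.2 fun z (hz : edist β (b z) < s / 2) (hz' : edist β' (b z) < s / 2) => ?_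
  refine (hT hβ hβ' hne).not_ge ?_
  calc edist β β' ≤ edist β (b z) + edist β' (b z) := edist_triangle_right _ _ _
    _ ≤ s / 2 + s / 2 := add_le_add hz.le hz'.le
    _ = s := ENNReal.add_halves s

variable [MeasurableSpace M] [OpensMeasurableSpace M] {Ω : Type*} [MeasurableSpace Ω]

theorem sq_mul_one_sub_le_lintegral_edist_sq (ν : Measure Ω) [IsProbabilityMeasure ν] {b : Ω → M}
    (hb : Measurable b) (β : M) (r : ℝ≥0∞) :
    r ^ 2 * (1 - ν {z | edist β (b z) < r}) ≤ ∫⁻ z, edist β (b z) ^ 2 ∂ν := by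
  have hdist : Measurable fun z => edist β (b z) := measurable_edist_right.comp hb
  calc r ^ 2 * (1 - ν {z | edist β (b z) < r})
      = r ^ 2 * ν {z | edist β (b z) < r}ᶜ := by
        rw [prob_compl_eq_one_sub (measurableSet_lt hdist measurable_const)]
    _ ≤ r ^ 2 * ν {z | r ^ 2 ≤ edist β (b z) ^ 2} := by
        gcongr
        intro z hz
        have hr : r ≤ edist β (b z) := not_lt.1 hz
        exact pow_le_pow_left' hr 2
    _ ≤ ∫⁻ z, edist β (b z) ^ 2 ∂ν := mul_meas_ge_le_lintegral (hdist.pow_const 2) _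

theorem sq_div_eight_le_iSup_lintegral_edist_sq {ν : M → Measure Ω}
    [∀ β, IsProbabilityMeasure (ν β)] {b : Ω → M} (hb : Measurable b) {s : ℝ≥0∞} {T : Finset M}
    (hTne : T.Nonempty)
    (htest : ∑ β ∈ T, ν β {z | edist β (b z) < s / 2} ≤ T.card / 2) :
    s ^ 2 / 8 ≤ ⨆ β, ∫⁻ z, edist β (b z) ^ 2 ∂ν β := by
  set A : M → Set Ω := fun β => {z | edist β (b z) < s / 2}
  obtain ⟨β, -, hβ⟩ : ∃ β ∈ T, ν β (A β) ≤ 2⁻¹ :=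
    ENNReal.exists_le_of_sum_le hTne <| by
      rwa [Finset.sum_const, nsmul_eq_mul, ← div_eq_mul_inv]
  have hmiss : 2⁻¹ ≤ 1 - ν β (A β) := by
    rw [← ENNReal.one_sub_inv_two]
    gcongr
  calc s ^ 2 / 8 = (s / 2) ^ 2 * 2⁻¹ := by
        rw [div_eq_mul_inv, div_eq_mul_inv, mul_pow, mul_assoc, ← pow_succ,
          ← ENNReal.inv_pow]
        norm_num
    _ ≤ (s / 2) ^ 2 * (1 - ν β (A β)) := by gcongr
    _ ≤ ∫⁻ z, edist β (b z) ^ 2 ∂ν β := sq_mul_one_sub_le_lintegral_edist_sq _ hb β _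
    _ ≤ _ := le_iSup (fun β => ∫⁻ z, edist β (b z) ^ 2 ∂ν β) β

theorem sq_div_eight_le_iSup_lintegral_edist_sq_of_withDensity {Q : Measure Ω}
    [IsProbabilityMeasure Q] {ν : M → Measure Ω} [∀ β, IsProbabilityMeasure (ν β)]
    {L : M → Ω → ℝ≥0∞} (hν : ∀ β, ν β = Q.withDensity (L β)) {b : Ω → M} (hb : Measurable b)
    {s B : ℝ≥0∞} {T : Finset M} (hTne : T.Nonempty) (hT : IsSeparated s (T : Set M))
    (hB : ∀ β ∈ T, ∫⁻ z, L β z ^ 2 ∂Q ≤ B) (hcard : 16 * B ≤ T.card) :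
    s ^ 2 / 8 ≤ ⨆ β, ∫⁻ z, edist β (b z) ^ 2 ∂ν β := by
  refine sq_div_eight_le_iSup_lintegral_edist_sq hb hTne ?_
  simp_rw [hν]
  exact sum_withDensity_apply_le_card_div_two Q
    (fun β _ => measurableSet_lt (measurable_edist_right.comp hb) measurable_const)
    (pairwiseDisjoint_edist_lt_half hT b) hB hcard

end Estimation

section LogisticModel

/-- The probability of the response `y` in a logistic model with log odds `t`. -/
noncomputable def logisticProb (t : ℝ) (y : Bool) : ℝ :=
  if y then Real.sigmoid t else 1 - Real.sigmoid t

theorem logisticProb_pos (t : ℝ) (y : Bool) : 0 < logisticProb t y := by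
  unfold logisticProb
  split_ifs
  · exact Real.sigmoid_pos t
  · exact sub_pos.2 (Real.sigmoid_lt_one t)

theorem measurable_logisticProb : Measurable fun z : ℝ × Bool => logisticProb z.1 z.2 := by
  have hsig : Measurable fun z : ℝ × Bool => Real.sigmoid z.1 :=
    continuous_sigmoid.measurable.comp measurable_fst
  exact Measurable.ite (measurable_snd (measurableSet_singleton true)) hsig
    (measurable_const.sub hsig)

theorem sigmoid_eq_exp_div (t : ℝ) : Real.sigmoid t = Real.exp t / (1 + Real.exp t) := by
  rw [Real.sigmoid_def, Real.exp_neg]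
  field_simp
  ring

theorem sum_logisticProb_sq_div_le_cosh (a b : ℝ) :
    ∑ y, logisticProb a y ^ 2 / logisticProb b y ≤ (1 + Real.cosh (a - b)) / 2 := by
  set X := Real.exp a with hX
  set Y := Real.exp b with hY
  have hX0 : 0 < X := Real.exp_pos a
  have hY0 : 0 < Y := Real.exp_pos b
  have hσa : Real.sigmoid a = X / (1 + X) := sigmoid_eq_exp_div a
  have hσb : Real.sigmoid b = Y / (1 + Y) := sigmoid_eq_exp_div b
  have hsum : ∑ y, logisticProb a y ^ 2 / logisticProb b y =
      (1 + Y) * (X ^ 2 + Y) / (Y * (1 + X) ^ 2) := by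
    simp only [Fintype.sum_bool, logisticProb, if_true, Bool.false_eq_true, if_false, hσa, hσb]
    have h1 : 1 - X / (1 + X) = 1 / (1 + X) := by field_simp; ring
    have h2 : 1 - Y / (1 + Y) = 1 / (1 + Y) := by field_simp; ring
    rw [h1, h2]
    field_simp
  have hcosh : (1 + Real.cosh (a - b)) / 2 = (X + Y) ^ 2 / (4 * (X * Y)) := by
    rw [Real.cosh_eq, neg_sub, Real.exp_sub, Real.exp_sub, ← hX, ← hY]
    field_simp
    ring
  -- AM-GM for `X (1 + Y)` and `X ^ 2 + Y`, whose sum is `(1 + X) (X + Y)`.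
  have hamgm : 4 * (X * (1 + Y)) * (X ^ 2 + Y) ≤ (X * (1 + Y) + (X ^ 2 + Y)) ^ 2 :=
    four_mul_le_sq_add _ _
  rw [hsum, hcosh, div_le_div_iff₀ (by positivity) (by positivity)]
  nlinarith [hamgm, hY0]

theorem cosh_le_one_add_sq {x : ℝ} (hx : |x| ≤ 1) : Real.cosh x ≤ 1 + x ^ 2 := by
  have hx2 : |x ^ 2 / 2| ≤ 1 := by
    rw [abs_of_nonneg (by positivity)]
    nlinarith [(sq_le_one_iff_abs_le_one x).2 hx]
  have hexp := (le_abs_self _).trans (Real.abs_exp_sub_one_le hx2)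
  rw [abs_of_nonneg (by positivity)] at hexp
  linarith [Real.cosh_le_exp_half_sq x]

theorem sum_logisticProb_sq_div_le {a b : ℝ} (hab : |a - b| ≤ 1) :
    ∑ y, logisticProb a y ^ 2 / logisticProb b y ≤ 1 + (a - b) ^ 2 / 2 := by
  linarith [sum_logisticProb_sq_div_le_cosh a b, cosh_le_one_add_sq hab]

variable {Ω : Type*} [MeasurableSpace Ω]

theorem lintegral_prod_count {ι : Type*} [Fintype ι] [MeasurableSpace ι]
    [MeasurableSingletonClass ι] (P : Measure Ω) {f : Ω × ι → ℝ≥0∞}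
    (hf : Measurable f) :
    ∫⁻ z, f z ∂(P.prod Measure.count) = ∫⁻ x, ∑ y, f (x, y) ∂P := by
  rw [lintegral_prod _ hf.aemeasurable]
  simp_rw [lintegral_count, tsum_fintype]

/-- The law of `(X, Y)` when `X` has law `P` and `Y` given `X` follows the logistic model with log
odds `h X`. -/
noncomputable def logisticLaw (P : Measure Ω) (h : Ω → ℝ) : Measure (Ω × Bool) :=
  (P.prod Measure.count).withDensity fun z => ENNReal.ofReal (logisticProb (h z.1) z.2)

/-- The density of `logisticLaw P g` with respect to `logisticLaw P h`. -/
noncomputable def logisticRatio (h g : Ω → ℝ) (z : Ω × Bool) : ℝ≥0∞ :=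
  ENNReal.ofReal (logisticProb (g z.1) z.2 / logisticProb (h z.1) z.2)

variable {g h : Ω → ℝ}

theorem measurable_logisticProb_comp (hh : Measurable h) :
    Measurable fun z : Ω × Bool => logisticProb (h z.1) z.2 :=
  measurable_logisticProb.comp ((hh.comp measurable_fst).prodMk measurable_snd)

theorem measurable_logisticRatio (hh : Measurable h) (hg : Measurable g) :
    Measurable (logisticRatio h g) :=
  ((measurable_logisticProb_comp hg).div (measurable_logisticProb_comp hh)).ennreal_ofReal

theorem lintegral_logisticLaw (P : Measure Ω) (hh : Measurable h) {f : Ω × Bool → ℝ≥0∞}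
    (hf : Measurable f) :
    ∫⁻ z, f z ∂logisticLaw P h =
      ∫⁻ x, ∑ y, ENNReal.ofReal (logisticProb (h x) y) * f (x, y) ∂P := by
  have hp := (measurable_logisticProb_comp hh).ennreal_ofReal
  rw [logisticLaw, lintegral_withDensity_eq_lintegral_mul _ hp hf,
    lintegral_prod_count P (hp.mul hf)]
  rfl

theorem isProbabilityMeasure_logisticLaw (P : Measure Ω) [IsProbabilityMeasure P]
    (hh : Measurable h) : IsProbabilityMeasure (logisticLaw P h) := by
  constructor
  have htotal : ∀ t, ∑ y, ENNReal.ofReal (logisticProb t y) = 1 := fun t => by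
    rw [← ENNReal.ofReal_sum_of_nonneg fun y _ => (logisticProb_pos t y).le]
    simp [logisticProb]
  rw [← lintegral_one, lintegral_logisticLaw P hh measurable_const]
  simp_rw [mul_one, htotal, lintegral_one, measure_univ]

theorem logisticLaw_withDensity_logisticRatio (P : Measure Ω) (hh : Measurable h)
    (hg : Measurable g) :
    (logisticLaw P h).withDensity (logisticRatio h g) = logisticLaw P g := by
  rw [logisticLaw, ← withDensity_mul _ (measurable_logisticProb_comp hh).ennreal_ofReal
    (measurable_logisticRatio hh hg), logisticLaw]
  congr 1
  funext z
  have hpos := logisticProb_pos (h z.1) z.2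
  rw [Pi.mul_apply, logisticRatio, ← ENNReal.ofReal_mul hpos.le, mul_div_cancel₀ _ hpos.ne']

theorem lintegral_logisticRatio_sq_le (P : Measure Ω) [IsProbabilityMeasure P]
    (hh : Measurable h) (hg : Measurable g) (hgh : ∀ x, |g x - h x| ≤ 1) :
    ∫⁻ z, logisticRatio h g z ^ 2 ∂logisticLaw P h ≤
      1 + ∫⁻ x, ENNReal.ofReal ((g x - h x) ^ 2 / 2) ∂P := by
  have hmul : ∀ x y, ENNReal.ofReal (logisticProb (h x) y) * logisticRatio h g (x, y) ^ 2 =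
      ENNReal.ofReal (logisticProb (g x) y ^ 2 / logisticProb (h x) y) := fun x y => by
    have hposh := logisticProb_pos (h x) y
    have hposg := logisticProb_pos (g x) y
    rw [logisticRatio, ← ENNReal.ofReal_pow (by positivity), ← ENNReal.ofReal_mul hposh.le]
    congr 1
    field_simp
  rw [lintegral_logisticLaw P hh ((measurable_logisticRatio hh hg).pow_const 2)]
  calc ∫⁻ x, ∑ y, ENNReal.ofReal (logisticProb (h x) y) * logisticRatio h g (x, y) ^ 2 ∂P
      = ∫⁻ x, ENNReal.ofReal (∑ y, logisticProb (g x) y ^ 2 / logisticProb (h x) y) ∂P := by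
        refine lintegral_congr fun x => ?_
        simp_rw [hmul]
        exact (ENNReal.ofReal_sum_of_nonneg fun y _ =>
          div_nonneg (sq_nonneg _) (logisticProb_pos (h x) y).le).symm
    _ ≤ ∫⁻ x, (1 + ENNReal.ofReal ((g x - h x) ^ 2 / 2)) ∂P := by
        refine lintegral_mono fun x => ?_
        rw [← ENNReal.ofReal_one, ← ENNReal.ofReal_add zero_le_one (by positivity)]
        exact ENNReal.ofReal_le_ofReal (sum_logisticProb_sq_div_le (hgh x))
    _ = 1 + ∫⁻ x, ENNReal.ofReal ((g x - h x) ^ 2 / 2) ∂P := by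
        rw [lintegral_add_left measurable_const, lintegral_one, measure_univ]

end LogisticModel

section LogOdds

variable {M : Type*} [MetricSpace M] {C α : ℝ}

theorem comparisonAngle_comm (p q r : M) : comparisonAngle p q r = comparisonAngle p r q := by
  unfold comparisonAngle
  rw [dist_comm q r, add_comm (dist p q ^ 2), mul_right_comm]

theorem angle_comm (p q r : M) : angle p q r = angle p r q := by
  unfold angle geodesicAngle
  congr! 4 with ρ
  ext θ
  constructor <;> rintro ⟨t, s, ht, htρ, hs, hsρ, rfl⟩ <;>
    exact ⟨s, t, hs, hsρ, ht, htρ, comparisonAngle_comm _ _ _⟩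

theorem ProjectionHolder.abs_logOdds_sub_le (hM : ProjectionHolder M C α) (μ β β' x : M) :
    |logOdds β x μ - logOdds β' x μ| ≤ C * dist β β' ^ α * dist μ x := by
  rcases eq_or_ne x μ with rfl | hx
  · simp [logOdds]
  · have hfactor : logOdds β x μ - logOdds β' x μ =
        (dist μ β * Real.cos (angle μ x β) - dist μ β' * Real.cos (angle μ x β')) * dist μ x := by
      unfold logOdds
      ring
    rw [hfactor, abs_mul, abs_dist]
    gcongr
    exact hM μ β β' x hx

theorem ProjectionHolder.continuous_logOdds (hM : ProjectionHolder M C α) (hα : 0 < α)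
    (μ β : M) : Continuous fun x => logOdds β x μ := by
  rcases eq_or_ne β μ with rfl | hβ
  · simpa [logOdds] using continuous_const
  have hproj : Continuous fun x => dist μ x * Real.cos (angle μ β x) := by
    refine continuous_iff_continuousAt.2 fun x => tendsto_iff_dist_tendsto_zero.2 ?_
    have hmodulus : Tendsto (fun y => C * dist y x ^ α) (𝓝 x) (𝓝 0) := by
      have hdist : Tendsto (fun y => dist y x) (𝓝 x) (𝓝 0) :=
        tendsto_iff_dist_tendsto_zero.1 tendsto_id
      simpa [Real.zero_rpow hα.ne'] using (hdist.rpow_const (Or.inr hα.le)).const_mul C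
    exact squeeze_zero (fun _ => dist_nonneg) (fun y => hM μ y x β hβ) hmodulus
  refine (continuous_const.mul hproj).congr (f := fun x => dist μ β * _) fun x => ?_
  rw [logOdds, angle_comm]
  ring

theorem ProjectionHolder.measurable_logOdds [MeasurableSpace M] [OpensMeasurableSpace M]
    (hM : ProjectionHolder M C α) (hα : 0 < α) (μ β : M) : Measurable fun x => logOdds β x μ :=
  (hM.continuous_logOdds hα μ β).measurable

end LogOdds

section FiniteSample

variable {M : Type*} [MetricSpace M] [MeasurableSpace M] {C α : ℝ}

theorem observationLaw_eq_logisticLaw (P : Measure M) (μ β : M) :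
    observationLaw P μ β = logisticLaw P fun x => logOdds β x μ :=
  rfl

variable (P : Measure M) [IsProbabilityMeasure P] {μ : M} {σ K R : ℝ}

theorem lintegral_logisticRatio_sq_le_of_abs_sub_le {g h : M → ℝ}
    (hh : Measurable h) (hg : Measurable g) (hK : 0 ≤ K)
    (hgh : ∀ x, |g x - h x| ≤ K * dist μ x) (hR : ∀ x, dist μ x ≤ R) (hKR : K * R ≤ 1)
    (hσ : frechetFunctional P μ ≤ ENNReal.ofReal (σ ^ 2)) :
    ∫⁻ z, logisticRatio h g z ^ 2 ∂logisticLaw P h ≤ ENNReal.ofReal (1 + K ^ 2 * σ ^ 2 / 2) := by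
  have hgh1 : ∀ x, |g x - h x| ≤ 1 := fun x =>
    (hgh x).trans ((mul_le_mul_of_nonneg_left (hR x) hK).trans hKR)
  have hsq : ∀ x, ENNReal.ofReal ((g x - h x) ^ 2 / 2) ≤
      ENNReal.ofReal (K ^ 2 / 2) * edist μ x ^ 2 := fun x => by
    rw [edist_dist, ← ENNReal.ofReal_pow dist_nonneg, ← ENNReal.ofReal_mul (by positivity)]
    refine ENNReal.ofReal_le_ofReal ?_
    linarith [sq_le_sq' (abs_le.1 (hgh x)).1 (abs_le.1 (hgh x)).2, mul_pow K (dist μ x) 2]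
  calc ∫⁻ z, logisticRatio h g z ^ 2 ∂logisticLaw P h
      ≤ 1 + ∫⁻ x, ENNReal.ofReal ((g x - h x) ^ 2 / 2) ∂P :=
        lintegral_logisticRatio_sq_le P hh hg hgh1
    _ ≤ 1 + ENNReal.ofReal (K ^ 2 / 2) * frechetFunctional P μ := by
        rw [frechetFunctional, ← lintegral_const_mul' _ _ ENNReal.ofReal_ne_top]
        gcongr with x
        exact hsq x
    _ ≤ 1 + ENNReal.ofReal (K ^ 2 / 2) * ENNReal.ofReal (σ ^ 2) := by gcongr
    _ = ENNReal.ofReal (1 + K ^ 2 * σ ^ 2 / 2) := by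
        rw [← ENNReal.ofReal_mul (by positivity), ← ENNReal.ofReal_one,
          ← ENNReal.ofReal_add zero_le_one (by positivity)]
        ring_nf

variable [OpensMeasurableSpace M]

theorem ProjectionHolder.isProbabilityMeasure_observationLaw (hM : ProjectionHolder M C α)
    (hα : 0 < α) (β : M) : IsProbabilityMeasure (observationLaw P μ β) := by
  rw [observationLaw_eq_logisticLaw]
  exact isProbabilityMeasure_logisticLaw P (hM.measurable_logOdds hα μ β)

/-- The density of the law of the sample `z` under `β` with respect to its law under `β₀`. -/
noncomputable def likelihoodRatio (μ β₀ β : M) {n : ℕ} (z : Fin n → M × Bool) : ℝ≥0∞ :=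
  ∏ i, logisticRatio (fun x => logOdds β₀ x μ) (fun x => logOdds β x μ) (z i)

theorem ProjectionHolder.sampleLaw_eq_withDensity (hM : ProjectionHolder M C α) (hα : 0 < α)
    (μ β₀ β : M) (n : ℕ) :
    sampleLaw P μ β n = (sampleLaw P μ β₀ n).withDensity (likelihoodRatio μ β₀ β) := by
  have hmeas := hM.measurable_logOdds hα μ
  have hprob : ∀ β, IsProbabilityMeasure (observationLaw P μ β) :=
    hM.isProbabilityMeasure_observationLaw P hα
  have hlaw := logisticLaw_withDensity_logisticRatio P (hmeas β₀) (hmeas β)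
  simp only [← observationLaw_eq_logisticLaw] at hlaw
  have : IsProbabilityMeasure ((observationLaw P μ β₀).withDensity
    (logisticRatio (fun x => logOdds β₀ x μ) fun x => logOdds β x μ)) := hlaw ▸ hprob β
  rw [sampleLaw, ← hlaw]
  exact pi_withDensity _ fun _ => measurable_logisticRatio (hmeas β₀) (hmeas β)

theorem ProjectionHolder.lintegral_likelihoodRatio_sq_le (hM : ProjectionHolder M C α)
    (hα : 0 < α) (hC : 0 ≤ C) {δ : ℝ} {β₀ β : M} (hβ : dist β β₀ ≤ δ)
    (hR : ∀ x, dist μ x ≤ R) (hδR : C * δ ^ α * R ≤ 1)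
    (hσ : frechetFunctional P μ ≤ ENNReal.ofReal (σ ^ 2)) (n : ℕ) :
    ∫⁻ z, likelihoodRatio μ β₀ β z ^ 2 ∂sampleLaw P μ β₀ n ≤
      ENNReal.ofReal (Real.exp ((C * δ ^ α) ^ 2 * σ ^ 2 * n / 2)) := by
  have hδ : 0 ≤ δ := dist_nonneg.trans hβ
  have hmeas := hM.measurable_logOdds hα μ
  have hprob := hM.isProbabilityMeasure_observationLaw P hα (μ := μ) β₀
  have hdiff : ∀ x, |logOdds β x μ - logOdds β₀ x μ| ≤ C * δ ^ α * dist μ x := fun x =>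
    (hM.abs_logOdds_sub_le μ β β₀ x).trans (by gcongr)
  simp_rw [likelihoodRatio, ← Finset.prod_pow]
  rw [sampleLaw, lintegral_pi_prod _ fun _ =>
    (measurable_logisticRatio (hmeas β₀) (hmeas β)).pow_const 2, Finset.prod_const,
    Finset.card_univ, Fintype.card_fin]
  calc _ ≤ ENNReal.ofReal (1 + (C * δ ^ α) ^ 2 * σ ^ 2 / 2) ^ n :=
        pow_le_pow_left' (lintegral_logisticRatio_sq_le_of_abs_sub_le P (hmeas β₀) (hmeas β)
          (by positivity) hdiff hR hδR hσ) n
    _ ≤ ENNReal.ofReal (Real.exp ((C * δ ^ α) ^ 2 * σ ^ 2 / 2)) ^ n := by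
        gcongr
        rw [add_comm]
        exact Real.add_one_le_exp _
    _ = ENNReal.ofReal (Real.exp ((C * δ ^ α) ^ 2 * σ ^ 2 * n / 2)) := by
        rw [← ENNReal.ofReal_pow (Real.exp_pos _).le, ← Real.exp_nat_mul]
        ring_nf

theorem ProjectionHolder.sq_div_eight_le_minimaxRisk (hM : ProjectionHolder M C α) (hα : 0 < α)
    (hC : 0 ≤ C) {δ : ℝ} {s : ℝ≥0∞} {β₀ : M} {T : Finset M} (hTδ : (T : Set M) ⊆ closedBall β₀ δ)
    (hTs : IsSeparated s (T : Set M)) (hR : ∀ x, dist μ x ≤ R) (hδR : C * δ ^ α * R ≤ 1)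
    (hσ : frechetFunctional P μ ≤ ENNReal.ofReal (σ ^ 2)) {n : ℕ}
    (hcard : 16 * Real.exp ((C * δ ^ α) ^ 2 * σ ^ 2 * n / 2) ≤ T.card) :
    s ^ 2 / 8 ≤ minimaxRisk P μ n := by
  have hTne : T.Nonempty := by
    rw [← Finset.card_pos, ← Nat.cast_pos (α := ℝ)]
    exact (by positivity : (0 : ℝ) < 16 * Real.exp _).trans_le hcard
  have hprob : ∀ β, IsProbabilityMeasure (observationLaw P μ β) :=
    hM.isProbabilityMeasure_observationLaw P hα
  have : ∀ β, IsProbabilityMeasure (sampleLaw P μ β n) := fun β => by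
    unfold sampleLaw
    infer_instance
  refine le_iInf₂ fun b hb => ?_
  refine sq_div_eight_le_iSup_lintegral_edist_sq_of_withDensity
    (hM.sampleLaw_eq_withDensity P hα μ β₀ · n) hb hTne hTs
    (fun β hβ => hM.lintegral_likelihoodRatio_sq_le P hα hC (hTδ hβ) hR hδR hσ n) ?_
  rw [← ENNReal.ofReal_ofNat 16, ← ENNReal.ofReal_mul (by norm_num), ← ENNReal.ofReal_natCast]
  exact ENNReal.ofReal_le_ofReal hcard

end FiniteSample

section Entropy

theorem exists_card_le_card_mul_card_fiber {ι κ : Type*} [DecidableEq κ] {s : Finset ι}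
    {t : Finset κ} {f : ι → κ} (ht : t.Nonempty) (hf : ∀ x ∈ s, f x ∈ t) :
    ∃ y ∈ t, s.card ≤ t.card * (s.filter fun x => f x = y).card := by
  refine Finset.exists_le_of_sum_le ht ?_
  rw [← Finset.mul_sum, ← Finset.card_eq_sum_card_fiberwise hf, Finset.sum_const, smul_eq_mul]

theorem exists_isSeparated_finset {X : Type*} [PseudoEMetricSpace X] {ε : ℝ≥0} {A : Set X}
    {n : ℕ} (hn : n ≤ packingNumber ε A) :
    ∃ S : Finset X, (S : Set X) ⊆ A ∧ IsSeparated ε (S : Set X) ∧ S.card = n := by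
  cases n with
  | zero => exact ⟨∅, by simp⟩
  | succ k =>
    have hk : (k : ℕ∞) < packingNumber ε A := (Nat.cast_lt.2 k.lt_succ_self).trans_le hn
    simp only [packingNumber, lt_iSup_iff] at hk
    obtain ⟨S, hSA, hS, hkS⟩ := hk
    obtain ⟨T, hTS, hT⟩ := Set.exists_subset_encard_eq (Order.add_one_le_of_lt hkS)
    have hTfin : T.Finite := Set.finite_of_encard_eq_coe hT
    refine ⟨hTfin.toFinset, by simpa using hTS.trans hSA, by simpa using hS.subset hTS, ?_⟩
    rwa [hTfin.encard_eq_coe_toFinset_card, ← Nat.cast_add_one, Nat.cast_inj] at hT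

variable {M : Type*} [PseudoMetricSpace M] {δ : ℝ≥0}

theorem exists_finset_iUnion_closedBall_eq_univ (hδ : coveringNumber δ (univ : Set M) ≠ ⊤) :
    ∃ C : Finset M, C.card = (coveringNumber δ (univ : Set M)).toNat ∧
      ⋃ c ∈ C, closedBall c δ = univ := by
  obtain ⟨C, -, hC, hcover, hcard⟩ := exists_set_encard_eq_coveringNumber hδ
  refine ⟨hC.toFinset, ?_, ?_⟩
  · rw [← hcard, hC.encard_eq_coe_toFinset_card, ENat.toNat_natCast]
  · simpa using univ_subset_iff.1 hcover.subset_iUnion_closedBall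

theorem toNat_coveringNumber_univ_pos [Nonempty M] (hδ : coveringNumber δ (univ : Set M) ≠ ⊤) :
    (0 : ℝ) < (coveringNumber δ (univ : Set M)).toNat :=
  Nat.cast_pos.2 (ENat.toNat_pos (coveringNumber_pos_iff.2 univ_nonempty).ne' hδ)

theorem exists_isSeparated_subset_closedBall [Nonempty M]
    (hδ : coveringNumber δ (univ : Set M) ≠ ⊤) (ε : ℝ≥0) :
    ∃ (x : M) (T : Finset M), (T : Set M) ⊆ closedBall x δ ∧ IsSeparated ε (T : Set M) ∧
      (coveringNumber ε (univ : Set M)).toNat ≤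
        (coveringNumber δ (univ : Set M)).toNat * T.card := by
  classical
  obtain ⟨C, hCcard, hC⟩ := exists_finset_iUnion_closedBall_eq_univ hδ
  obtain ⟨S, -, hS, hScard⟩ := exists_isSeparated_finset
    ((ENat.natCast_toNat_le_self _).trans (coveringNumber_le_packingNumber ε (univ : Set M)))
  have hcenter : ∀ x, ∃ c ∈ C, x ∈ closedBall c δ := fun x => by
    simpa using hC.ge (mem_univ x)
  choose center hcenterC hcenter using hcenter
  have hCne : C.Nonempty := ⟨_, hcenterC (Classical.arbitrary M)⟩
  obtain ⟨x, -, hx⟩ := exists_card_le_card_mul_card_fiber (s := S) hCne fun y _ => hcenterC y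
  refine ⟨x, S.filter fun y => center y = x, fun y hy => ?_,
    hS.subset (Finset.coe_subset.2 (Finset.filter_subset _ _)), ?_⟩
  · rw [← (Finset.mem_filter.1 hy).2]
    exact hcenter y
  · rwa [hScard, hCcard] at hx

theorem isBounded_univ_of_coveringNumber_ne_top (hδ : coveringNumber δ (univ : Set M) ≠ ⊤) :
    Bornology.IsBounded (univ : Set M) := by
  obtain ⟨C, -, hC⟩ := exists_finset_iUnion_closedBall_eq_univ hδ
  rw [← hC]
  exact (Bornology.isBounded_biUnion_finset C).2 fun _ _ => isBounded_closedBall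

theorem dist_le_coveringNumber_mul [PreconnectedSpace M]
    (hδ : coveringNumber δ (univ : Set M) ≠ ⊤) (p q : M) :
    dist p q ≤ (coveringNumber δ (univ : Set M)).toNat * (2 * δ) := by
  obtain ⟨C, hCcard, hC⟩ := exists_finset_iUnion_closedBall_eq_univ hδ
  have hcover : Icc 0 (dist p q) ⊆ ⋃ c ∈ C, closedBall (dist p c) δ := by
    intro t ht
    have hrange : t ∈ range (dist p) :=
      intermediate_value_univ p q (by fun_prop) (by rwa [dist_self])
    obtain ⟨x, rfl⟩ := hrange
    obtain ⟨c, hc, hxc⟩ := mem_iUnion₂.1 (hC.ge (mem_univ x))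
    refine mem_iUnion₂.2 ⟨c, hc, ?_⟩
    rw [mem_closedBall, dist_comm p, dist_comm p]
    exact (dist_dist_dist_le_left x c p).trans hxc
  have hvol := (measure_mono (μ := volume) hcover).trans (measure_biUnion_finset_le _ _)
  simp only [Real.volume_Icc, sub_zero, Real.volume_closedBall, Finset.sum_const, nsmul_eq_mul,
    hCcard] at hvol
  rw [← ENNReal.ofReal_natCast, ← ENNReal.ofReal_mul (by positivity)] at hvol
  exact (ENNReal.ofReal_le_ofReal_iff (by positivity)).1 hvol

end Entropy

section EntropyGrowth

variable {M : Type*} [MetricSpace M] {c₁ c₂ D : ℝ}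

theorem IsGeodesic.continuousOn {γ : ℝ → M} {p q : M} (hγ : IsGeodesic γ p q) :
    ContinuousOn γ (Icc 0 (dist p q)) :=
  (LipschitzOnWith.of_dist_le_mul (K := 1) fun s hs t ht => by
    simpa [Real.dist_eq] using (hγ.2.2 s hs t ht).le).continuousOn

theorem UniquelyGeodesic.preconnectedSpace (hM : UniquelyGeodesic M) : PreconnectedSpace M := by
  refine ⟨isPreconnected_of_forall_pair fun p _ q _ => ?_⟩
  obtain ⟨γ, hγ, -⟩ := hM p q
  exact ⟨γ '' Icc 0 (dist p q), subset_univ _, ⟨0, left_mem_Icc.2 dist_nonneg, hγ.1⟩,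
    ⟨dist p q, right_mem_Icc.2 dist_nonneg, hγ.2.1⟩, isPreconnected_Icc.image γ hγ.continuousOn⟩

theorem tendsto_coe_rpow_nhdsGT_zero {a : ℝ} (ha : 0 < a) :
    Tendsto (fun δ : ℝ≥0 => (δ : ℝ) ^ a) (𝓝[>] 0) (𝓝 0) := by
  have hcont : Continuous fun δ : ℝ≥0 => (δ : ℝ) ^ a :=
    (Real.continuous_rpow_const ha.le).comp NNReal.continuous_coe
  have hlim := hcont.tendsto 0
  rw [NNReal.coe_zero, Real.zero_rpow ha.ne'] at hlim
  exact hlim.mono_left nhdsWithin_le_nhds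

theorem tendsto_const_mul_nhdsGT_zero {η : ℝ≥0} (hη : 0 < η) :
    Tendsto (fun δ : ℝ≥0 => η * δ) (𝓝[>] 0) (𝓝[>] 0) := by
  refine tendsto_nhdsWithin_iff.2 ⟨?_, ?_⟩
  · have hlim := (continuous_const_mul η).tendsto 0
    rw [mul_zero] at hlim
    exact hlim.mono_left nhdsWithin_le_nhds
  · filter_upwards [self_mem_nhdsWithin] with δ hδ
    exact mul_pos hη hδ

theorem LogPolynomialEntropy.one_le [PreconnectedSpace M] [Nontrivial M]
    (hM : LogPolynomialEntropy M c₁ c₂ D) : 1 ≤ D := by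
  obtain ⟨p, q, hpq⟩ := exists_pair_ne M
  by_contra! hD
  have hbound : ∀ᶠ δ : ℝ≥0 in 𝓝[>] 0, dist p q ≤ c₂ * 2 * (δ : ℝ) ^ (1 - D) := by
    filter_upwards [hM, self_mem_nhdsWithin] with δ ⟨hfin, _, hle⟩ (hδ : 0 < δ)
    have hδ' : (0 : ℝ) < δ := hδ
    calc dist p q ≤ (coveringNumber δ (univ : Set M)).toNat * (2 * δ) :=
          dist_le_coveringNumber_mul hfin p q
      _ ≤ c₂ * (1 / δ) ^ D * (2 * δ) := by gcongr
      _ = c₂ * 2 * (δ : ℝ) ^ (1 - D) := by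
          rw [one_div, Real.inv_rpow hδ'.le, Real.rpow_sub hδ', Real.rpow_one]
          ring
  have hlim := (tendsto_coe_rpow_nhdsGT_zero (sub_pos.2 hD)).const_mul (c₂ * 2)
  rw [mul_zero] at hlim
  exact (ge_of_tendsto hlim hbound).not_gt (dist_pos.2 hpq)

theorem LogPolynomialEntropy.le (hM : LogPolynomialEntropy M c₁ c₂ D) : c₁ ≤ c₂ := by
  obtain ⟨δ, ⟨-, hlower, hupper⟩, hδ : 0 < δ⟩ := (hM.and self_mem_nhdsWithin).exists
  exact le_of_mul_le_mul_right (hlower.trans hupper) (by positivity)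

/-- Shrinking a small radius `δ` by the factor `η` multiplies the covering number of `M` by at
least `16 exp (τ δ⁻ᴰ)`. Both entropy conditions enter the lower bound for the minimax risk only
through this property. -/
def CoveringNumberGrowth (M : Type*) [MetricSpace M] (η : ℝ≥0) (τ D : ℝ) : Prop :=
  ∀ᶠ δ : ℝ≥0 in 𝓝[>] 0,
    coveringNumber δ (univ : Set M) ≠ ⊤ ∧
    16 * Real.exp (τ * (1 / (δ : ℝ)) ^ D) * (coveringNumber δ (univ : Set M)).toNat ≤
      (coveringNumber (η * δ) (univ : Set M)).toNat

theorem LogPolynomialEntropy.coveringNumberGrowth (hM : LogPolynomialEntropy M c₁ c₂ D)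
    (hc₁ : 0 < c₁) (hc₂ : 0 < c₂) (hD : 1 ≤ D) {η : ℝ≥0}
    (hη : (η : ℝ) = c₁ / (16 * Real.exp 1 * c₂)) : CoveringNumberGrowth M η D 0 := by
  have hη0 : 0 < η := by
    rw [← NNReal.coe_pos, hη]
    positivity
  have hconst : 16 * Real.exp D * c₂ ≤ c₁ * (1 / η) ^ D := by
    have hratio : 1 ≤ 16 * c₂ / c₁ := by
      rw [le_div_iff₀ hc₁]
      linarith [hM.le]
    calc 16 * Real.exp D * c₂ = c₁ * (Real.exp D * (16 * c₂ / c₁)) := by field_simp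
      _ ≤ c₁ * (Real.exp D * (16 * c₂ / c₁) ^ D) := by
          gcongr
          exact Real.self_le_rpow_of_one_le hratio hD
      _ = c₁ * (1 / η) ^ D := by
          rw [← Real.exp_one_rpow D, ← Real.mul_rpow (by positivity) (by positivity), hη]
          congr 2
          field_simp
  filter_upwards [hM, (tendsto_const_mul_nhdsGT_zero hη0).eventually hM]
    with δ ⟨hfin, _, hupper⟩ ⟨_, hlower, _⟩
  refine ⟨hfin, ?_⟩
  calc 16 * Real.exp (D * (1 / (δ : ℝ)) ^ (0 : ℝ)) * (coveringNumber δ (univ : Set M)).toNat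
      ≤ 16 * Real.exp D * (c₂ * (1 / δ) ^ D) := by
        rw [Real.rpow_zero, mul_one]
        gcongr
    _ = 16 * Real.exp D * c₂ * (1 / δ) ^ D := by ring
    _ ≤ c₁ * (1 / η) ^ D * (1 / δ) ^ D := by gcongr
    _ = c₁ * (1 / (η * δ : ℝ≥0)) ^ D := by
        rw [mul_assoc, ← Real.mul_rpow (by positivity) (by positivity), NNReal.coe_mul,
          one_div_mul_one_div]
    _ ≤ (coveringNumber (η * δ) (univ : Set M)).toNat := hlower

theorem PolynomialEntropy.coveringNumberGrowth [Nonempty M] (hM : PolynomialEntropy M c₁ c₂ D)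
    (hc₁ : 0 < c₁) (hc₂ : 0 < c₂) (hD : 0 < D) {η : ℝ≥0}
    (hη : (η : ℝ) = (c₁ / (c₂ + 2)) ^ (1 / D)) : CoveringNumberGrowth M η 1 D := by
  have hη0 : 0 < η := by
    rw [← NNReal.coe_pos, hη]
    positivity
  have hηD : c₁ * (1 / η) ^ D = c₂ + 2 := by
    rw [one_div, Real.inv_rpow η.coe_nonneg, hη, ← Real.rpow_mul (by positivity),
      one_div_mul_cancel hD.ne', Real.rpow_one]
    field_simp
  have hsmall : ∀ᶠ δ : ℝ≥0 in 𝓝[>] 0, (δ : ℝ) ^ D < 1 / Real.log 16 :=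
    (tendsto_coe_rpow_nhdsGT_zero hD).eventually (gt_mem_nhds (by positivity))
  filter_upwards [hM, (tendsto_const_mul_nhdsGT_zero hη0).eventually hM, hsmall,
    self_mem_nhdsWithin] with δ ⟨hfin, _, hupper⟩ ⟨hfin', hlower, _⟩ hδlog (hδ : 0 < δ)
  have hδ' : (0 : ℝ) < δ := hδ
  refine ⟨hfin, ?_⟩
  have hlog : Real.log 16 ≤ (1 / (δ : ℝ)) ^ D := by
    rw [one_div, Real.inv_rpow hδ'.le, ← one_div]
    exact ((lt_one_div (by positivity) (by positivity)).1 hδlog).le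
  rw [NNReal.coe_mul, ← one_div_mul_one_div, Real.mul_rpow (by positivity) (by positivity),
    ← mul_assoc, hηD] at hlower
  have hposδ := toNat_coveringNumber_univ_pos hfin
  rw [← Real.log_le_log_iff (by positivity) (toNat_coveringNumber_univ_pos hfin'),
    Real.log_mul (by positivity) hposδ.ne', Real.log_mul (by norm_num) (Real.exp_pos _).ne',
    Real.log_exp]
  linarith

end EntropyGrowth

section Rates

/-- The radius at which the exponent `(C δᵅ)² σ² n / 2` in the second moment of the likelihood
ratio equals the exponent `τ δ⁻ᴰ` in `CoveringNumberGrowth`. -/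
noncomputable def criticalRadius (C α σ τ D : ℝ) (n : ℕ) : ℝ≥0 :=
  ((2 / C ^ 2 * (τ / (σ ^ 2 * n))) ^ (1 / (2 * α + D))).toNNReal

variable {C α σ τ D : ℝ}

theorem coe_criticalRadius (hτ : 0 ≤ τ) (n : ℕ) :
    (criticalRadius C α σ τ D n : ℝ) =
      (2 / C ^ 2 * (τ / (σ ^ 2 * n))) ^ (1 / (2 * α + D)) :=
  Real.coe_toNNReal _ (by positivity)

theorem criticalRadius_pos (hC : 0 < C) (hσ : 0 < σ) (hτ : 0 < τ) {n : ℕ} (hn : 0 < n) :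
    0 < criticalRadius C α σ τ D n := by
  exact Real.toNNReal_pos.2 (by positivity)

theorem tendsto_criticalRadius (hα : 0 < α) (hC : 0 < C) (hσ : 0 < σ) (hτ : 0 < τ) (hD : 0 ≤ D) :
    Tendsto (criticalRadius C α σ τ D) atTop (𝓝[>] 0) := by
  have hexp : 0 < 1 / (2 * α + D) := by positivity
  refine tendsto_nhdsWithin_iff.2 ⟨?_, ?_⟩
  · rw [← NNReal.tendsto_coe]
    simp_rw [coe_criticalRadius hτ.le, ← div_div]
    have hlim := ((tendsto_const_div_atTop_nhds_zero_nat (τ / σ ^ 2)).const_mul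
      (2 / C ^ 2)).rpow_const (p := 1 / (2 * α + D)) (Or.inr hexp.le)
    simpa only [mul_zero, Real.zero_rpow hexp.ne', NNReal.coe_zero] using hlim
  · filter_upwards [eventually_gt_atTop 0] with n hn
    exact criticalRadius_pos hC hσ hτ hn

theorem criticalRadius_balance (hα : 0 < α) (hC : 0 < C) (hσ : 0 < σ) (hτ : 0 < τ) (hD : 0 ≤ D)
    {n : ℕ} (hn : 0 < n) :
    (C * (criticalRadius C α σ τ D n : ℝ) ^ α) ^ 2 * σ ^ 2 * n / 2 =
      τ * (1 / (criticalRadius C α σ τ D n : ℝ)) ^ D := by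
  set δ := (criticalRadius C α σ τ D n : ℝ) with hδ
  have hδ0 : 0 < δ := NNReal.coe_pos.2 (criticalRadius_pos hC hσ hτ hn)
  have hpow : (δ ^ α) ^ 2 * δ ^ D = 2 / C ^ 2 * (τ / (σ ^ 2 * n)) := by
    rw [← Real.rpow_mul_natCast hδ0.le, ← Real.rpow_add hδ0, hδ, coe_criticalRadius hτ.le,
      ← Real.rpow_mul (by positivity), Nat.cast_ofNat, mul_comm α,
      one_div_mul_cancel (by positivity), Real.rpow_one]
  rw [one_div, Real.inv_rpow hδ0.le, ← div_eq_mul_inv, eq_div_iff (by positivity)]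
  calc (C * δ ^ α) ^ 2 * σ ^ 2 * n / 2 * δ ^ D
      = C ^ 2 * σ ^ 2 * n / 2 * ((δ ^ α) ^ 2 * δ ^ D) := by ring
    _ = τ := by
      rw [hpow]
      field_simp

theorem criticalRadius_sq (hτ : 0 ≤ τ) (n : ℕ) :
    (criticalRadius C α σ τ D n : ℝ) ^ 2 =
      (2 / C ^ 2) ^ (1 / (α + D / 2)) * (τ / (σ ^ 2 * n)) ^ (1 / (α + D / 2)) := by
  have hexp : 1 / (2 * α + D) * (2 : ℕ) = 1 / (α + D / 2) := by
    rw [show 2 * α + D = (α + D / 2) * 2 by ring, Nat.cast_ofNat, ← div_div,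
      div_mul_cancel₀ _ two_ne_zero]
  rw [coe_criticalRadius hτ, ← Real.rpow_mul_natCast (by positivity), hexp,
    Real.mul_rpow (by positivity) (by positivity)]

variable {M : Type*} [MetricSpace M] [MeasurableSpace M]

theorem nontrivial_of_frechetFunctional_ne_zero {P : Measure M} {μ : M}
    (h : frechetFunctional P μ ≠ 0) : Nontrivial M := by
  by_contra hM
  have := not_nontrivial_iff_subsingleton.1 hM
  have hμ : ∀ x, x = μ := fun x => Subsingleton.elim x μ
  exact h (by simp [frechetFunctional, hμ])

variable [OpensMeasurableSpace M] (P : Measure M) [IsProbabilityMeasure P] {μ : M}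

theorem ProjectionHolder.sq_div_eight_le_minimaxRisk_of_coveringNumber
    (hM : ProjectionHolder M C α) (hα : 0 < α) (hC : 0 ≤ C) {δ ε : ℝ≥0}
    (hδ : coveringNumber δ (univ : Set M) ≠ ⊤) {R : ℝ} (hR : ∀ x, dist μ x ≤ R)
    (hδR : C * (δ : ℝ) ^ α * R ≤ 1) (hσ : frechetFunctional P μ ≤ ENNReal.ofReal (σ ^ 2)) {n : ℕ}
    (hcard : 16 * Real.exp ((C * (δ : ℝ) ^ α) ^ 2 * σ ^ 2 * n / 2) *
        (coveringNumber δ (univ : Set M)).toNat ≤ (coveringNumber ε (univ : Set M)).toNat) :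
    ENNReal.ofReal ((ε : ℝ) ^ 2 / 8) ≤ minimaxRisk P μ n := by
  have : Nonempty M := ⟨μ⟩
  obtain ⟨β₀, T, hTδ, hTε, hT⟩ := exists_isSeparated_subset_closedBall hδ ε
  have hT' : ((coveringNumber ε (univ : Set M)).toNat : ℝ) ≤
      T.card * (coveringNumber δ (univ : Set M)).toNat := by
    rw [mul_comm]
    exact_mod_cast hT
  rw [ENNReal.ofReal_div_of_pos (by norm_num), ENNReal.ofReal_pow ε.coe_nonneg,
    ENNReal.ofReal_coe_nnreal, ENNReal.ofReal_ofNat]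
  exact hM.sq_div_eight_le_minimaxRisk P hα hC hTδ hTε hR hδR hσ
    (le_of_mul_le_mul_right (hcard.trans hT') (toNat_coveringNumber_univ_pos hδ))

theorem CoveringNumberGrowth.eventually_le_minimaxRisk {η : ℝ≥0}
    (hgrowth : CoveringNumberGrowth M η τ D) (hM : ProjectionHolder M C α) (hα : 0 < α)
    (hC : 0 < C) (hτ : 0 < τ) (hD : 0 ≤ D) (hσ : 0 < σ)
    (hσP : frechetFunctional P μ ≤ ENNReal.ofReal (σ ^ 2)) :
    ∀ᶠ n : ℕ in atTop, ENNReal.ofReal ((η : ℝ) ^ 2 / 8 * (2 / C ^ 2) ^ (1 / (α + D / 2)) *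
      (τ / (σ ^ 2 * n)) ^ (1 / (α + D / 2))) ≤ minimaxRisk P μ n := by
  obtain ⟨_, hfin, -⟩ := hgrowth.exists
  obtain ⟨R, hR⟩ : ∃ R, ∀ x, dist μ x ≤ R := by
    obtain ⟨R, hR⟩ := (isBounded_univ_of_coveringNumber_ne_top hfin).subset_closedBall μ
    exact ⟨R, fun x => mem_closedBall'.1 (hR (mem_univ x))⟩
  have hsmall : ∀ᶠ δ : ℝ≥0 in 𝓝[>] 0, C * (δ : ℝ) ^ α * R ≤ 1 := by
    have hlim := ((tendsto_coe_rpow_nhdsGT_zero hα).const_mul C).mul_const R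
    rw [mul_zero, zero_mul] at hlim
    exact hlim.eventually (ge_mem_nhds one_pos)
  have hδ := tendsto_criticalRadius hα hC hσ hτ hD
  filter_upwards [hδ.eventually hgrowth, hδ.eventually hsmall, eventually_gt_atTop 0]
    with n ⟨hfin, hcard⟩ hδR hn
  rw [← criticalRadius_balance hα hC hσ hτ hD hn] at hcard
  have hrisk := hM.sq_div_eight_le_minimaxRisk_of_coveringNumber P hα hC.le hfin hR hδR hσP hcard
  rw [NNReal.coe_mul, mul_pow, criticalRadius_sq hτ.le] at hrisk
  convert hrisk using 2
  ring

theorem LogPolynomialEntropy.eventually_le_minimaxRisk {c₁ c₂ : ℝ}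
    (hentropy : LogPolynomialEntropy M c₁ c₂ D) (hc₁ : 0 < c₁) (hc₂ : 0 < c₂)
    (hG : UniquelyGeodesic M) (hM : ProjectionHolder M C α) (hα : 0 < α) (hC : 0 < C) (hσ : 0 < σ)
    (hσP : frechetFunctional P μ = ENNReal.ofReal (σ ^ 2)) :
    ∀ᶠ n : ℕ in atTop, ENNReal.ofReal ((c₁ / (16 * Real.exp 1 * c₂)) ^ 2 / 8 *
      (2 / C ^ 2) ^ (1 / α) * (D / (σ ^ 2 * n)) ^ (1 / α)) ≤ minimaxRisk P μ n := by
  have := hG.preconnectedSpace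
  have : Nontrivial M := nontrivial_of_frechetFunctional_ne_zero (P := P) (μ := μ) <| by
    rw [hσP]
    simpa using hσ.ne'
  have hD : 1 ≤ D := hentropy.one_le
  have hη : ((c₁ / (16 * Real.exp 1 * c₂)).toNNReal : ℝ) = c₁ / (16 * Real.exp 1 * c₂) :=
    Real.coe_toNNReal _ (by positivity)
  have hrisk := (hentropy.coveringNumberGrowth hc₁ hc₂ hD hη).eventually_le_minimaxRisk P hM hα hC
    (one_pos.trans_le hD) le_rfl hσ hσP.le
  simpa only [hη, zero_div, add_zero] using hrisk

theorem PolynomialEntropy.eventually_le_minimaxRisk {c₁ c₂ : ℝ}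
    (hentropy : PolynomialEntropy M c₁ c₂ D) (hc₁ : 0 < c₁) (hc₂ : 0 < c₂) (hD : 0 < D)
    (hM : ProjectionHolder M C α) (hα : 0 < α) (hC : 0 < C) (hσ : 0 < σ)
    (hσP : frechetFunctional P μ ≤ ENNReal.ofReal (σ ^ 2)) :
    ∀ᶠ n : ℕ in atTop, ENNReal.ofReal (((c₁ / (c₂ + 2)) ^ (1 / D)) ^ 2 / 8 *
      (2 / C ^ 2) ^ (1 / (α + D / 2)) * (1 / (σ ^ 2 * n)) ^ (1 / (α + D / 2))) ≤
        minimaxRisk P μ n := by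
  have : Nonempty M := ⟨μ⟩
  have hη : (((c₁ / (c₂ + 2)) ^ (1 / D)).toNNReal : ℝ) = (c₁ / (c₂ + 2)) ^ (1 / D) :=
    Real.coe_toNNReal _ (by positivity)
  have hrisk := (hentropy.coveringNumberGrowth hc₁ hc₂ hD hη).eventually_le_minimaxRisk P hM hα hC
    one_pos hD.le hσ hσP
  rwa [hη] at hrisk

end Rates

end MetricRegression

theorem mainTheorem5_general (C_U α_U c₁ c₂ : ℝ) (hC_U : 0 < C_U) (hα_pos : 0 < α_U)
    (hc₁ : 0 < c₁) (hc₂ : 0 < c₂) :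
    (∃ c : ℝ, 0 < c ∧ ∀ D : ℝ,
      ∀ (M : Type*) [MetricSpace M] [MeasurableSpace M] [OpensMeasurableSpace M],
        MetricRegression.UniquelyGeodesic M → MetricRegression.ProjectionHolder M C_U α_U →
        MetricRegression.LogPolynomialEntropy M c₁ c₂ D →
        ∀ (P : Measure M) [IsProbabilityMeasure P] (μ : M) (σ : ℝ), 0 < σ →
          MetricRegression.frechetFunctional P μ = ENNReal.ofReal (σ ^ 2) →
            ∀ᶠ n : ℕ in atTop,
              ENNReal.ofReal (c * (D / (σ ^ 2 * n)) ^ (1 / α_U)) ≤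
                MetricRegression.minimaxRisk P μ n) ∧
    (∀ D : ℝ, 0 < D → ∃ c : ℝ, 0 < c ∧
      ∀ (M : Type*) [MetricSpace M] [MeasurableSpace M] [OpensMeasurableSpace M],
        MetricRegression.UniquelyGeodesic M → MetricRegression.ProjectionHolder M C_U α_U →
        MetricRegression.PolynomialEntropy M c₁ c₂ D →
        ∀ (P : Measure M) [IsProbabilityMeasure P] (μ : M) (σ : ℝ), 0 < σ →
          MetricRegression.frechetFunctional P μ = ENNReal.ofReal (σ ^ 2) →
            ∀ᶠ n : ℕ in atTop,
              ENNReal.ofReal (c * (1 / (σ ^ 2 * n)) ^ (1 / (α_U + D / 2))) ≤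
                MetricRegression.minimaxRisk P μ n) :=
  ⟨⟨(c₁ / (16 * Real.exp 1 * c₂)) ^ 2 / 8 * (2 / C_U ^ 2) ^ (1 / α_U), by positivity,
      fun _ _ _ _ _ hG hM hentropy P _ _ _ hσ hσP =>
        hentropy.eventually_le_minimaxRisk P hc₁ hc₂ hG hM hα_pos hC_U hσ hσP⟩,
    fun D hD => ⟨((c₁ / (c₂ + 2)) ^ (1 / D)) ^ 2 / 8 * (2 / C_U ^ 2) ^ (1 / (α_U + D / 2)),
      by positivity, fun _ _ _ _ _ hM hentropy P _ _ _ hσ hσP =>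
        hentropy.eventually_le_minimaxRisk P hc₁ hc₂ hD hM hα_pos hC_U hσ hσP.le⟩⟩

theorem mainTheorem5 (C_U α_U c₁ c₂ : ℝ) (hC_U : 0 < C_U) (hα_pos : 0 < α_U) (hα_le : α_U ≤ 1)
    (hc₁ : 0 < c₁) (hc₂ : 0 < c₂) :
    (∃ c : ℝ, 0 < c ∧ ∀ D : ℝ, 0 < D →
      ∀ (M : Type*) [MetricSpace M] [CompleteSpace M] [MeasurableSpace M] [BorelSpace M],
        MetricRegression.UniquelyGeodesic M → MetricRegression.ProjectionHolder M C_U α_U →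
        MetricRegression.LogPolynomialEntropy M c₁ c₂ D →
        ∀ (P : Measure M) [IsProbabilityMeasure P] (μ : M),
          MetricRegression.IsFrechetMean P μ →
          ∀ σ : ℝ, 0 < σ → MetricRegression.frechetFunctional P μ = ENNReal.ofReal (σ ^ 2) →
            ∀ᶠ n : ℕ in atTop,
              ENNReal.ofReal (c * (D / (σ ^ 2 * n)) ^ (1 / α_U)) ≤
                MetricRegression.minimaxRisk P μ n) ∧
    (∀ D : ℝ, 0 < D → ∃ c : ℝ, 0 < c ∧
      ∀ (M : Type*) [MetricSpace M] [CompleteSpace M] [MeasurableSpace M] [BorelSpace M],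
        MetricRegression.UniquelyGeodesic M → MetricRegression.ProjectionHolder M C_U α_U →
        MetricRegression.PolynomialEntropy M c₁ c₂ D →
        ∀ (P : Measure M) [IsProbabilityMeasure P] (μ : M),
          MetricRegression.IsFrechetMean P μ →
          ∀ σ : ℝ, 0 < σ → MetricRegression.frechetFunctional P μ = ENNReal.ofReal (σ ^ 2) →
            ∀ᶠ n : ℕ in atTop,
              ENNReal.ofReal (c * (1 / (σ ^ 2 * n)) ^ (1 / (α_U + D / 2))) ≤
                MetricRegression.minimaxRisk P μ n) := by
  obtain ⟨⟨c, hc, hrisk⟩, hrisk'⟩ := mainTheorem5_general C_U α_U c₁ c₂ hC_U hα_pos hc₁ hc₂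
  refine ⟨⟨c, hc, fun D _ M _ _ _ _ hG hM hentropy P _ μ _ => hrisk D M hG hM hentropy P μ⟩,
    fun D hD => ?_⟩
  obtain ⟨c, hc, hrisk⟩ := hrisk' D hD
  exact ⟨c, hc, fun M _ _ _ _ hG hM hentropy P _ μ _ => hrisk M hG hM hentropy P μ⟩
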